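/- Consider a network of $n$ scalar subsystems $\dot x_i=\sum_{j\ne i}a_{ij}x_j+b_iu$, $i=1,\dots,n$, with input $u(t)\in\mathbb R^m$ and outputs $y_i=x_i$, i.e. $\Sigma:\ \dot x=Ax+Bu,\ y=x$ with $A_{ii}=0$, regarded as a structured system: $a_{ij}$ ($i\ne j$) is a free real parameter if $(j,i)$ is an edge of a given directed interconnection graph and $a_{ij}=0$ otherwise; each entry of $B$ is either a free real parameter or fixed to zero. Let $\mathrm G(\Sigma)$ be the directed graph with state nodes $\mathcal V=\{x_1,\dots,x_n\}$, input nodes $u_1,\dots,u_m$, an edge $x_j\to x_i$ whenever $A_{ij}$ is free, and an edge $u_s\to x_i$ whenever $B_{is}$ is free. A stem is a sequence of distinct nodes, consecutive ones joined by edges, that starts at an input node and ends at a state node; a cycle is an elementary directed cycle with at least one edge. Assume that $\Sigma$ is input-accessible, i.e. every state node is the end vertex of a stem. Replacing the subsystems with indices in a set $R\subseteq\{1,\dots,n\}$ by first-order heterogeneous ones means adding to the right-hand side of the $i$-th equation, for each $i\in R$, a term $\hat a_i x_i$ with $\hat a_i$ a further free real parameter, and leaving everything else, including the output, unchanged. The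 resulting structured system $\hat\Sigma$ is structurally output controllable if, for some choice of the free parameters, its output controllability matrix $\hat C[\hat B\ \hat A\hat B\ \cdots\ \hat A^{n-1}\hat B]$ (where $\hat C=I$) has full row rank $n$. Let $\mathcal Z\subseteq\mathcal V$ be a set of maximum cardinality among the sets of state nodes that can be covered by vertex-disjoint stems and cycles in $\mathrm G(\Sigma)$. Then the minimum number of subsystems that must be replaced by first-order heterogeneous ones to attain structural output controllability is exactly $S=n-|\mathcal Z|$: it is attained for some $R$ with $|R|=n-|\mathcal Z|$, and for no $R$ with $|R|<n-|\mathcal Z|$. -/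

import Mathlib

/-- The controllability matrix `[B  AB  ⋯  A^(N-1) B]`, where `N` is the number of states.
Its columns are indexed by pairs (power of `A`, input). -/
def controllabilityMatrix {ι μ : Type*} [Fintype ι] [DecidableEq ι]
    (A : Matrix ι ι ℝ) (B : Matrix ι μ ℝ) : Matrix ι (Fin (Fintype.card ι) × μ) ℝ :=
  Matrix.of fun i p => (A ^ (p.1 : ℕ) * B) i p.2

/-- A structured linear system `x' = A x + B u`, `y = C x` with states `ι`, inputs `μ`, outputs `π`:
the positions of the free entries of `A` and of `B` (all other entries are zero), and the set of
admissible numerical values of `C`. -/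
structure StructuredSystem (ι μ π : Type*) where
  /-- `freeA i j`: the entry `A i j` may be chosen arbitrarily. -/
  freeA : ι → ι → Prop
  /-- `freeB i s`: the entry `B i s` may be chosen arbitrarily. -/
  freeB : ι → μ → Prop
  /-- The admissible output matrices. -/
  outputs : Set (Matrix π ι ℝ)

namespace StructuredSystem

variable {ι μ π : Type*}

/-- `(A, B, C)` is a numerical realization of the structured system. -/
def IsRealization (S : StructuredSystem ι μ π)
    (A : Matrix ι ι ℝ) (B : Matrix ι μ ℝ) (C : Matrix π ι ℝ) : Prop :=
  (∀ i j, ¬ S.freeA i j → A i j = 0) ∧ (∀ i s, ¬ S.freeB i s → B i s = 0) ∧ C ∈ S.outputs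

/-- Structural output controllability: for some numerical realization, the output controllability
matrix `C [B  AB  ⋯  A^(N-1) B]` has full row rank. -/
def StructurallyOutputControllable [Fintype ι] [DecidableEq ι] [Fintype μ] [Fintype π]
    (S : StructuredSystem ι μ π) : Prop :=
  ∃ A B C, S.IsRealization A B C ∧
    (C * controllabilityMatrix A B).rank = Fintype.card π

/-- The directed graph of a structured system. Its nodes are the states (`Sum.inl`) and the inputs
(`Sum.inr`); there is an edge `j → i` when `A i j` is free and an edge `s → i` when `B i s` is free.
No edge enters an input. -/
def graph (S : StructuredSystem ι μ π) : Digraph (ι ⊕ μ) where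
  Adj v w :=
    match v, w with
    | .inl j, .inl i => S.freeA i j
    | .inr s, .inl i => S.freeB i s
    | _, .inr _ => False

/-- A stem: a sequence of distinct nodes along edges, from an input node to a state node. -/
def IsStem (S : StructuredSystem ι μ π) (l : List (ι ⊕ μ)) : Prop :=
  l.Nodup ∧ l.IsChain S.graph.Adj ∧
    (∃ s, l.head? = some (Sum.inr s)) ∧ ∃ i, l.getLast? = some (Sum.inl i)

/-- An elementary cycle, listed without repeating its first node at the end: a nonempty sequence of
distinct nodes along edges, with an edge from the last node back to the first. A self-loop is
an elementary cycle with one node. -/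
def IsElementaryCycle (S : StructuredSystem ι μ π) (l : List (ι ⊕ μ)) : Prop :=
  l.Nodup ∧ l.IsChain S.graph.Adj ∧ ∃ h : l ≠ [], S.graph.Adj (l.getLast h) (l.head h)

/-- Every state node is the end vertex of a stem. -/
def InputAccessible (S : StructuredSystem ι μ π) : Prop :=
  ∀ i, ∃ l, S.IsStem l ∧ l.getLast? = some (Sum.inl i)

/-- The set `Z` of state nodes can be covered by vertex-disjoint stems and elementary cycles. -/
def Coverable (S : StructuredSystem ι μ π) (Z : Finset ι) : Prop :=
  ∃ P : Set (List (ι ⊕ μ)),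
    (∀ l ∈ P, S.IsStem l ∨ S.IsElementaryCycle l) ∧
    P.Pairwise List.Disjoint ∧
    ∀ i ∈ Z, ∃ l ∈ P, Sum.inl i ∈ l

/-- `Z` has maximum cardinality among the sets of state nodes that can be covered by
vertex-disjoint stems and elementary cycles. -/
def IsMaxCoverable (S : StructuredSystem ι μ π) (Z : Finset ι) : Prop :=
  S.Coverable Z ∧ ∀ Z' : Finset ι, S.Coverable Z' → Z'.card ≤ Z.card

end StructuredSystem

/-- The interconnection structure of a network of `n` scalar subsystems with `m` external inputs:
the directed interconnection graph of the subsystems (without self-loops), and the subsystems that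
each input component enters directly. -/
structure Network (n m : ℕ) where
  /-- `G₀.Adj j i`: subsystem `j` influences subsystem `i`. -/
  G₀ : Digraph (Fin n)
  loopless : ∀ i, ¬ G₀.Adj i i
  /-- `inp i s`: the input component `s` enters subsystem `i` directly. -/
  inp : Fin n → Fin m → Prop

namespace Network

variable {n m : ℕ}

/-- The original network: identical first-order subsystems with trivial internal dynamics (the
diagonal of `A` is zero because the interconnection graph has no self-loop), and `C = I`. -/
def original (N : Network n m) : StructuredSystem (Fin n) (Fin m) (Fin n) where
  freeA i j := N.G₀.Adj j i
  freeB i s := N.inp i s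
  outputs := {1}

/-- The extended network in which subsystem `i` has order `ord i ≥ 1`. Its internal dynamics is
an arbitrary matrix if `i ∈ het` and zero otherwise. The block from `j` to `i ≠ j` is free
when `j` influenced `i` originally and zero otherwise, similarly for the inputs. The output matrix
is block diagonal, with blocks `c i` that are arbitrary rows if `ord i > 1` and equal to `1` if
`ord i = 1`. A subsystem with `ord i = 1` and `i ∉ het` is the original one. -/
def extended (N : Network n m) (ord : Fin n → ℕ) (het : Finset (Fin n)) :
    StructuredSystem (Σ i : Fin n, Fin (ord i)) (Fin m) (Fin n) where
  freeA p q := (p.1 = q.1 ∧ p.1 ∈ het) ∨ (p.1 ≠ q.1 ∧ N.G₀.Adj q.1 p.1)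
  freeB p s := N.inp p.1 s
  outputs := {C | (∀ i p, p.1 ≠ i → C i p = 0) ∧ ∀ i p, p.1 = i → ord i = 1 → C i p = 1}

/-- The extended network obtained by replacing exactly the subsystems in `R` with first-order
heterogeneous ones. -/
def replaceFirstOrder (N : Network n m) (R : Finset (Fin n)) :
    StructuredSystem (Σ _ : Fin n, Fin 1) (Fin m) (Fin n) :=
  N.extended (fun _ => 1) R

end Network

/-! The bridge between algebra and combinatorics is an injective map `f` sending each state to a
predecessor, a state or an input. Stems and cycles that cover a set yield such a map on it, and
iterating `f` backwards recovers stems and cycles. A heterogeneous subsystem is a state that may be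
its own predecessor.

Lower bound: controllability makes the rows of `[A B]` independent, so Hall's theorem
(`exists_injective_entry_ne_zero`) gives distinct predecessors, and only states of `R` can be their
own. Extending the predecessor relation to a permutation of all nodes and cutting its orbits at the
inputs covers every state outside `R` (`StructuredSystem.coverable_of_injective`), so `n - |R| ≤
|Z|`.

Upper bound: take `R` to be the complement of `Z`. Predecessors in the covering on `Z`, together
with self-loops off `Z`, form an injective `f`. It remains to prove the sufficiency half of Lin's
theorem (`exists_real_controllable`). The states that `f` traces back to inputs form a controllable
pair with unit weights. The other states split into cycles, attached one at a time by an edge that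
accessibility provides. A large cycle weight forces any eigenvalue active on the new cycle to have
large modulus, where the old part admits no matching left eigenvector (`ControllableOn.add_cycle`).
-/

open Matrix in
/-- The Popov–Belevitch–Hautus test for the pair `(A, B)` on row vectors supported in `V`: no such
left eigenvector of `A` is annihilated by `B`. -/
def HautusOn {ι μ : Type*} [Fintype ι] (V : Finset ι) (A : Matrix ι ι ℂ) (B : Matrix ι μ ℂ) : Prop :=
  ∀ (v : ι → ℂ) (z : ℂ), (∀ i ∉ V, v i = 0) → v ᵥ* A = z • v → v ᵥ* B = 0 → v = 0

/-! ### Hautus test and estimates for large eigenvalues -/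

section Hautus

open Matrix

variable {ι μ : Type*} [Fintype ι]

/-- The vectors annihilated by all `A ^ k * B` form an `A`-invariant subspace; over `ℂ`, if nonzero,
it contains a left eigenvector, which the Hautus test excludes. -/
theorem HautusOn.eq_zero_of_vecMul_pow [DecidableEq ι] {V : Finset ι} {A : Matrix ι ι ℂ} {B : Matrix ι μ ℂ}
    (h : HautusOn V A B) (hA : ∀ i j, A i j ≠ 0 → i ∈ V ∧ j ∈ V) {v : ι → ℂ}
    (hv : ∀ i ∉ V, v i = 0) (hvB : ∀ k : ℕ, v ᵥ* (A ^ k * B) = 0) : v = 0 := by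
  let W : Submodule ℂ (ι → ℂ) :=
    { carrier := {w | (∀ i ∉ V, w i = 0) ∧ ∀ k : ℕ, w ᵥ* (A ^ k * B) = 0}
      add_mem' := fun {a b} ha hb => ⟨fun i hi => by simp [ha.1 i hi, hb.1 i hi], fun k => by
        rw [add_vecMul, ha.2, hb.2, add_zero]⟩
      zero_mem' := ⟨fun i _ => rfl, fun k => zero_vecMul _⟩
      smul_mem' := fun c a ha => ⟨fun i hi => by simp [ha.1 i hi], fun k => by
        rw [smul_vecMul, ha.2, smul_zero]⟩ }
  have hinv : ∀ w ∈ W, (vecMulLinear A) w ∈ W := by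
    intro w hw
    refine ⟨fun j hj => ?_, fun k => ?_⟩
    · refine Finset.sum_eq_zero fun i _ => ?_
      have : A i j = 0 := by
        by_contra hne
        exact hj (hA i j hne).2
      simp [this]
    · rw [vecMulLinear_apply, vecMul_vecMul, ← Matrix.mul_assoc, ← pow_succ']
      exact hw.2 (k + 1)
  by_contra hne
  have : Nontrivial W := ⟨⟨⟨v, hv, hvB⟩, 0, fun e => hne (congrArg Subtype.val e)⟩⟩
  obtain ⟨z, hz⟩ := Module.End.exists_eigenvalue ((vecMulLinear A).restrict hinv)
  obtain ⟨w, hw⟩ := hz.exists_hasEigenvector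
  refine hw.2 (Subtype.ext (h w.1 z w.2.1 ?_ ?_))
  · exact congrArg Subtype.val hw.apply_eq_smul
  · simpa using w.2.2 0

theorem exists_norm_vecMul_le {κ : Type*} [Fintype κ] (M : Matrix ι κ ℂ) :
    ∃ a : ℝ, 0 ≤ a ∧ ∀ v : ι → ℂ, ‖v ᵥ* M‖ ≤ a * ‖v‖ :=
  ⟨‖LinearMap.toContinuousLinearMap (vecMulLinear M)‖, norm_nonneg _, fun v =>
    (LinearMap.toContinuousLinearMap (vecMulLinear M)).le_opNorm v⟩

/-- The resolvent equation `v A + c e = z v` bounds `v` when `z` has large modulus. -/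
theorem exists_resolvent_bound (A : Matrix ι ι ℂ) (e : ι → ℂ) :
    ∃ a : ℝ, ∀ (z c : ℂ) (v : ι → ℂ), v ᵥ* A + c • e = z • v →
      ‖v‖ * (‖z‖ - a) ≤ ‖c‖ * ‖e‖ := by
  obtain ⟨a, -, ha⟩ := exists_norm_vecMul_le A
  refine ⟨a, fun z c v h => ?_⟩
  have h1 : ‖z‖ * ‖v‖ ≤ ‖v ᵥ* A‖ + ‖c‖ * ‖e‖ := by
    rw [← norm_smul, ← h, ← norm_smul]
    exact norm_add_le _ _
  linarith [ha v]

/-- If some Markov parameter `e A ^ k B` is nonzero, then for `z` of large modulus, a solution of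
`v A + c e = z v`, `v B = 0` has `c = 0`. -/
theorem exists_bound_of_vecMul_pow_ne_zero [DecidableEq ι] [Fintype μ] (A : Matrix ι ι ℂ) (B : Matrix ι μ ℂ)
    (e : ι → ℂ) (he : ∃ k : ℕ, e ᵥ* (A ^ k * B) ≠ 0) :
    ∃ T : ℝ, ∀ (z c : ℂ) (v : ι → ℂ), T < ‖z‖ → v ᵥ* A + c • e = z • v → v ᵥ* B = 0 → c = 0 := by
  classical
  obtain ⟨K, hK, hmin⟩ : ∃ K, e ᵥ* (A ^ K * B) ≠ 0 ∧ ∀ k < K, e ᵥ* (A ^ k * B) = 0 :=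
    ⟨Nat.find he, Nat.find_spec he, fun k hk => not_not.1 (Nat.find_min he hk)⟩
  obtain ⟨a, ha⟩ := exists_resolvent_bound A e
  obtain ⟨b, hb0, hb⟩ := exists_norm_vecMul_le (A ^ (K + 1) * B)
  set m := ‖e ᵥ* (A ^ K * B)‖ with hm
  have hm0 : 0 < m := norm_pos_iff.2 hK
  -- The solution has norm at most `‖c‖ * ‖e‖ / (‖z‖ - a)`, while the first nonzero Markov parameter
  -- forces `‖c‖ * m ≤ b * ‖v‖`. Beyond this threshold the two are incompatible unless `c = 0`.
  refine ⟨max a (a + b * ‖e‖ / m), fun z c v hz hv hvB => ?_⟩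
  have hza : a < ‖z‖ := (le_max_left _ _).trans_lt hz
  have hzb : b * ‖e‖ / m < ‖z‖ - a := by
    have := (le_max_right _ _).trans_lt hz
    linarith
  have hstep : ∀ k : ℕ, v ᵥ* (A ^ (k + 1) * B) =
      z • (v ᵥ* (A ^ k * B)) - c • (e ᵥ* (A ^ k * B)) := by
    intro k
    rw [pow_succ', Matrix.mul_assoc, ← vecMul_vecMul, eq_sub_of_add_eq hv, sub_vecMul, smul_vecMul,
      smul_vecMul]
  have hzero : ∀ k ≤ K, v ᵥ* (A ^ k * B) = 0 := by
    intro k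
    induction k with
    | zero => intro _; simpa using hvB
    | succ k ih =>
      intro hk
      rw [hstep, ih (by omega), hmin k (by omega)]
      simp
  have hlast := hstep K
  rw [hzero K le_rfl, smul_zero, zero_sub] at hlast
  have h1 : ‖c‖ * m ≤ b * ‖v‖ := by
    have := hb v
    rwa [hlast, norm_neg, norm_smul] at this
  have h2 := ha z c v hv
  by_contra hc
  have hc0 : 0 < ‖c‖ := norm_pos_iff.2 hc
  rw [div_lt_iff₀ hm0] at hzb
  have hpos : 0 < ‖z‖ - a := by linarith
  have h3 : ‖c‖ * m * (‖z‖ - a) ≤ b * (‖c‖ * ‖e‖) :=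
    calc ‖c‖ * m * (‖z‖ - a) ≤ b * ‖v‖ * (‖z‖ - a) := mul_le_mul_of_nonneg_right h1 hpos.le
      _ = b * (‖v‖ * (‖z‖ - a)) := by ring
      _ ≤ _ := mul_le_mul_of_nonneg_left h2 hb0
  have h4 := mul_lt_mul_of_pos_left hzb hc0
  linarith

end Hautus

/-- `(A, B)` is a real pair with entries along the edges `E` of a graph, involving only the states
in `V`, that is controllable on `V`. -/
structure ControllableOn {ι μ : Type*} [Fintype ι] (E : ι ⊕ μ → ι → Prop) (V : Finset ι)
    (A : Matrix ι ι ℂ) (B : Matrix ι μ ℂ) : Prop where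
  im_A : ∀ i j, (A i j).im = 0
  im_B : ∀ i s, (B i s).im = 0
  edge_A : ∀ i j, A i j ≠ 0 → E (.inl j) i
  edge_B : ∀ i s, B i s ≠ 0 → E (.inr s) i
  supp_A : ∀ i j, A i j ≠ 0 → i ∈ V ∧ j ∈ V
  supp_B : ∀ i s, B i s ≠ 0 → i ∈ V
  hautus : HautusOn V A B

/-! ### Sufficiency in Lin's theorem: growing a controllable pair cycle by cycle -/

section Growth

open Matrix

variable {ι μ : Type*} [Fintype ι]

/-- The threshold for the weights of a cycle that is attached to a controllable pair by an edge
leaving `x`. -/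
theorem ControllableOn.exists_threshold [DecidableEq ι] [Fintype μ]
    [DecidableEq μ] {E : ι ⊕ μ → ι → Prop} {V : Finset ι}
    {A : Matrix ι ι ℂ} {B : Matrix ι μ ℂ} (h : ControllableOn E V A B) (x : ι ⊕ μ)
    (hx : ∀ j, x = .inl j → j ∈ V) :
    ∃ T : ℝ, ∀ (z c : ℂ) (v : ι → ℂ), T < ‖z‖ →
      v ᵥ* A + c • (fun j => if x = .inl j then 1 else 0) = z • v →
      v ᵥ* B + c • (fun s => if x = .inr s then 1 else 0) = 0 → c = 0 := by
  rcases x with j | s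
  · have hj := hx j rfl
    obtain ⟨T, hT⟩ := exists_bound_of_vecMul_pow_ne_zero A B
      (fun i => if (Sum.inl j : ι ⊕ μ) = .inl i then 1 else 0) (by
        by_contra! hall
        have := congrFun (h.hautus.eq_zero_of_vecMul_pow h.supp_A
          (fun i hi => if_neg fun e => hi (by simp at e; exact e ▸ hj)) hall) j
        simp at this)
    refine ⟨T, fun z c v hz hv hvB => hT z c v hz hv ?_⟩
    rw [← hvB]
    ext s
    simp
  -- When the edge leaves an input, the state equation is unforced, so a large `z` gives `v = 0`,
  -- and the input equation then reads `c = 0`.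
  · obtain ⟨a, ha⟩ := exists_resolvent_bound A 0
    refine ⟨a, fun z c v hz hv hvB => ?_⟩
    have := ha z c v (by rw [← hv]; ext j; simp)
    rw [norm_zero, mul_zero] at this
    have hv0 : v = 0 := by
      by_contra hne
      have := mul_pos (norm_pos_iff.2 hne) (sub_pos.2 hz)
      linarith
    have := congrFun hvB s
    simpa [hv0] using this

/-- The cycle of `σ` through `c` gets a common weight `t` above the threshold, and the edge from `x`
gets weight 1. A left eigenvector nonzero at `c` has an eigenvalue of modulus `t`, which the
threshold rules out. Once it vanishes at `c`, the old part and the cycle decouple. -/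
theorem ControllableOn.add_cycle [DecidableEq ι] [Fintype μ]
    [DecidableEq μ] {E : ι ⊕ μ → ι → Prop} {V : Finset ι}
    {A : Matrix ι ι ℂ} {B : Matrix ι μ ℂ} (h : ControllableOn E V A B) (σ : Equiv.Perm ι)
    (hσV : ∀ i, σ i ∈ V ↔ i ∈ V) (hσE : ∀ i ∉ V, E (.inl (σ i)) i) {c : ι} (hc : c ∉ V)
    {x : ι ⊕ μ} (hx : ∀ j, x = .inl j → j ∈ V) (hxc : E x c) :
    ∃ V' A' B', V ⊂ V' ∧ (∀ i, σ i ∈ V' ↔ i ∈ V') ∧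
      ControllableOn (ι := ι) (μ := μ) E V' A' B' := by
  classical
  obtain ⟨T, hT⟩ := h.exists_threshold x hx
  obtain ⟨t, htT, ht0⟩ : ∃ t : ℝ, T < t ∧ 0 < t := ⟨max T 0 + 1, by
    linarith [le_max_left T 0], by linarith [le_max_right T 0]⟩
  have hpowV : ∀ (k : ℕ) i, (σ ^ k) i ∈ V ↔ i ∈ V := by
    intro k
    induction k with
    | zero => simp
    | succ k ih => intro i; rw [pow_succ', Equiv.Perm.mul_apply, hσV, ih]
  have hdisj : ∀ i, σ.SameCycle c i → i ∉ V := by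
    intro i hi hiV
    obtain ⟨k, -, rfl⟩ := hi.exists_pow_eq'
    exact hc ((hpowV k c).1 hiV)
  let C : Finset ι := Finset.univ.filter fun i => σ.SameCycle c i
  have hC : ∀ i, i ∈ C ↔ σ.SameCycle c i := by simp [C]
  have hσC : ∀ i, σ i ∈ C ↔ i ∈ C := by simp [hC]
  have hcC : c ∈ C := (hC c).2 (Equiv.Perm.SameCycle.refl _ _)
  have hA0 : ∀ i ∉ V, ∀ j, A i j = 0 := fun i hi j => by
    by_contra hne
    exact hi (h.supp_A i j hne).1
  have hA0' : ∀ j ∉ V, ∀ i, A i j = 0 := fun j hj i => by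
    by_contra hne
    exact hj (h.supp_A i j hne).2
  have hB0 : ∀ i ∉ V, ∀ s, B i s = 0 := fun i hi s => by
    by_contra hne
    exact hi (h.supp_B i s hne)
  let A' : Matrix ι ι ℂ := fun i j => A i j +
    ((if i ∈ C ∧ σ i = j then (t : ℂ) else 0) + if i = c ∧ x = .inl j then 1 else 0)
  let B' : Matrix ι μ ℂ := fun i s => B i s + if i = c ∧ x = .inr s then 1 else 0
  refine ⟨V ∪ C, A', B', ?_, ?_, ?_, ?_, ?_, ?_, ?_, ?_, ?_⟩
  · refine Finset.ssubset_iff_subset_ne.2 ⟨Finset.subset_union_left, fun e => hc ?_⟩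
    rw [e]
    exact Finset.mem_union_right _ hcC
  · intro i
    rw [Finset.mem_union, Finset.mem_union, hσV, hσC]
  · intro i j
    simp only [A', Complex.add_im, h.im_A]
    split_ifs <;> simp
  · intro i s
    simp only [B', Complex.add_im, h.im_B]
    split_ifs <;> simp
  · intro i j hij
    by_cases h1 : i ∈ C ∧ σ i = j
    · rw [← h1.2]
      exact hσE i (hdisj i ((hC i).1 h1.1))
    · by_cases h2 : i = c ∧ x = .inl j
      · rw [h2.1, ← h2.2]
        exact hxc
      · exact h.edge_A i j (by simpa [A', h1, h2] using hij)
  · intro i s his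
    by_cases h2 : i = c ∧ x = .inr s
    · rw [h2.1, ← h2.2]
      exact hxc
    · exact h.edge_B i s (by simpa [B', h2] using his)
  · intro i j hij
    by_cases h1 : i ∈ C ∧ σ i = j
    · rw [← h1.2, Finset.mem_union, Finset.mem_union, hσC]
      exact ⟨Or.inr h1.1, Or.inr h1.1⟩
    · by_cases h2 : i = c ∧ x = .inl j
      · rw [h2.1]
        exact ⟨Finset.mem_union_right _ hcC, Finset.mem_union_left _ (hx j h2.2)⟩
      · have := h.supp_A i j (by simpa [A', h1, h2] using hij)
        exact ⟨Finset.mem_union_left _ this.1, Finset.mem_union_left _ this.2⟩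
  · intro i s his
    by_cases h2 : i = c ∧ x = .inr s
    · rw [h2.1]
      exact Finset.mem_union_right _ hcC
    · exact Finset.mem_union_left _ (h.supp_B i s (by simpa [B', h2] using his))
  -- `u` is the part of `v` on the old states; the cycle acts on it only through the forcing term `v
  -- c` along the edge from `x`.
  · intro v z hv hvA hvB
    let u : ι → ℂ := fun i => if i ∈ V then v i else 0
    have huA : u ᵥ* A = v ᵥ* A := by
      ext j
      refine Finset.sum_congr rfl fun i _ => ?_
      by_cases hi : i ∈ V <;> simp [u, hi, hA0]
    have huB : u ᵥ* B = v ᵥ* B := by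
      ext s
      refine Finset.sum_congr rfl fun i _ => ?_
      by_cases hi : i ∈ V <;> simp [u, hi, hB0]
    have hcycsum : ∀ j, ∑ i, v i * (if i ∈ C ∧ σ i = j then (t : ℂ) else 0) =
        if j ∈ C then v (σ.symm j) * t else 0 := by
      intro j
      rw [Finset.sum_eq_single (σ.symm j)]
      · have : σ.symm j ∈ C ↔ j ∈ C := by rw [← hσC, Equiv.apply_symm_apply]
        simp [this]
      · intro i _ hi
        rw [if_neg, mul_zero]
        rintro ⟨-, rfl⟩
        simp at hi
      · simp
    have hedgesum : ∀ (p : Prop) [Decidable p],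
        ∑ i, v i * (if i = c ∧ p then 1 else 0) = v c * if p then 1 else 0 := by
      intro p _
      rw [Finset.sum_eq_single c] <;> simp +contextual
    have hentry : ∀ j, (v ᵥ* A) j + ((if j ∈ C then v (σ.symm j) * t else 0) +
        v c * (if x = .inl j then 1 else 0)) = z * v j := by
      intro j
      have := congrFun hvA j
      simp only [vecMul, dotProduct, A', mul_add, Finset.sum_add_distrib, hcycsum] at this
      rw [← show (z • v) j = z * v j from rfl, ← this]
      exact congrArg (fun y => _ + (_ + y)) (hedgesum _).symm
    have hBentry : ∀ s, (v ᵥ* B) s + v c * (if x = .inr s then 1 else 0) = 0 := by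
      intro s
      have := congrFun hvB s
      simp only [vecMul, dotProduct, B', mul_add, Finset.sum_add_distrib] at this
      refine Eq.trans ?_ this
      exact congrArg (_ + ·) (hedgesum _).symm
    have hcyc : ∀ i ∈ C, z * v (σ i) = t * v i := by
      intro i hi
      have hiC : σ i ∈ C := (hσC i).2 hi
      have hiV : σ i ∉ V := hdisj _ ((hC _).1 hiC)
      have h1 : (v ᵥ* A) (σ i) = 0 := Finset.sum_eq_zero fun k _ =>
        mul_eq_zero_of_right _ (hA0' _ hiV k)
      have h2 : x ≠ .inl (σ i) := fun e => hiV (hx _ e)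
      rw [← hentry, h1]
      simp [hiC, h2, mul_comm]
    have hcycpow : ∀ k : ℕ, ∀ i ∈ C, z ^ k * v ((σ ^ k) i) = t ^ k * v i := by
      intro k
      induction k with
      | zero => simp
      | succ k ih =>
        intro i hi
        rw [pow_succ σ, Equiv.Perm.mul_apply, pow_succ', mul_assoc, ih _ ((hσC i).2 hi),
          mul_left_comm, hcyc i hi]
        ring
    have hu : u ᵥ* A + v c • (fun j => if x = .inl j then 1 else 0) = z • u := by
      ext j
      rw [huA]
      simp only [Pi.add_apply, Pi.smul_apply, smul_eq_mul]
      by_cases hj : j ∈ V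
      · have hjC : j ∉ C := fun e => hdisj j ((hC j).1 e) hj
        simpa [hjC, u, hj] using hentry j
      · have h2 : x ≠ .inl j := fun e => hj (hx _ e)
        have h1 : (v ᵥ* A) j = 0 := Finset.sum_eq_zero fun k _ =>
          mul_eq_zero_of_right _ (hA0' _ hj k)
        simp [h1, h2, u, hj]
    have huBe : u ᵥ* B + v c • (fun s => if x = .inr s then 1 else 0) = 0 := by
      ext s
      rw [huB]
      simpa using hBentry s
    have htC : (t : ℂ) ≠ 0 := by exact_mod_cast ht0.ne'
    have hvc : v c = 0 := by
      by_contra hne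
      -- Going once round the cycle gives `z ^ N = t ^ N` with `N = orderOf σ`.
      have hz : ‖z‖ = t := by
        have h1 := hcycpow (orderOf σ) c hcC
        rw [pow_orderOf_eq_one] at h1
        have h2 := mul_right_cancel₀ hne h1
        have h3 := congrArg norm h2
        rw [norm_pow, norm_pow, Complex.norm_real, Real.norm_of_nonneg ht0.le] at h3
        exact (pow_left_inj₀ (norm_nonneg _) ht0.le (orderOf_pos σ).ne').1 h3
      exact hne (hT z (v c) u (by rw [hz]; exact htT) hu huBe)
    have hu0 : u = 0 := by
      refine h.hautus u z (fun i hi => if_neg hi) ?_ ?_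
      · simpa [hvc] using hu
      · simpa [hvc] using huBe
    ext i
    by_cases hiV : i ∈ V
    · simpa [u, hiV] using congrFun hu0 i
    · by_cases hiC : i ∈ C
      · obtain ⟨k, -, hk⟩ := ((hC i).1 hiC).symm.exists_pow_eq'
        have := hcycpow k i hiC
        rw [hk, hvc, mul_zero] at this
        exact (mul_eq_zero.1 this.symm).resolve_left (pow_ne_zero _ htC)
      · exact hv i (by simp [hiV, hiC])

/-- The states whose iterated predecessors under `f` lead to an input. -/
inductive Rooted {ι μ : Type*} (f : ι → ι ⊕ μ) : ι → Prop
  | input {i : ι} {s : μ} (h : f i = .inr s) : Rooted f i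
  | state {i j : ι} (h : f i = .inl j) (hj : Rooted f j) : Rooted f i

/-- As `f` is injective, each column of `A` and `B` has at most one nonzero entry. Input columns
kill the first state of each path, and the eigenvector equation carries this zero along the path. -/
theorem exists_controllableOn_rooted [DecidableEq ι] [DecidableEq μ] {E : ι ⊕ μ → ι → Prop} {f : ι → ι ⊕ μ}
    (hf : Function.Injective f) (hfE : ∀ i, E (f i) i) (V : Finset ι)
    (hV : ∀ i, i ∈ V ↔ Rooted f i) : ∃ A B, ControllableOn E V A B := by
  classical
  have hstate : ∀ i j, i ∈ V → f i = .inl j → j ∈ V := by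
    intro i j hi hij
    rw [hV] at hi ⊢
    cases hi with
    | input h => rw [h] at hij; cases hij
    | state h hj => rw [h] at hij; cases hij; exact hj
  refine ⟨fun i j => if i ∈ V ∧ f i = .inl j then 1 else 0,
    fun i s => if i ∈ V ∧ f i = .inr s then 1 else 0, ?_, ?_, ?_, ?_, ?_, ?_, ?_⟩
  · intro i j
    split_ifs <;> simp
  · intro i j
    split_ifs <;> simp
  · intro i j hij
    simp only [ne_eq, ite_eq_right_iff, one_ne_zero, imp_false, not_not] at hij
    exact hij.2 ▸ hfE i
  · intro i j hij
    simp only [ne_eq, ite_eq_right_iff, one_ne_zero, imp_false, not_not] at hij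
    exact hij.2 ▸ hfE i
  · intro i j hij
    simp only [ne_eq, ite_eq_right_iff, one_ne_zero, imp_false, not_not] at hij
    exact ⟨hij.1, hstate i j hij.1 hij.2⟩
  · intro i j hij
    simp only [ne_eq, ite_eq_right_iff, one_ne_zero, imp_false, not_not] at hij
    exact hij.1
  · intro v z hv hvA hvB
    have hzero : ∀ i, Rooted f i → v i = 0 := by
      intro i hi
      induction hi with
      | @input i s h =>
        have hi : i ∈ V := (hV i).2 (.input h)
        have := congrFun hvB s
        simp only [vecMul, dotProduct] at this
        rw [Finset.sum_eq_single i] at this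
        · simpa [hi, h] using this
        · intro k _ hk
          rw [if_neg, mul_zero]
          rintro ⟨-, e⟩
          exact hk (hf (e.trans h.symm))
        · simp
      | @state i j h hj ih =>
        have hi : i ∈ V := (hV i).2 (.state h hj)
        have := congrFun hvA j
        simp only [vecMul, dotProduct, Pi.smul_apply, ih] at this
        rw [Finset.sum_eq_single i] at this
        · simpa [hi, h] using this
        · intro k _ hk
          rw [if_neg, mul_zero]
          rintro ⟨-, e⟩
          exact hk (hf (e.trans h.symm))
        · simp
    ext i
    by_cases hi : i ∈ V
    · exact hzero i ((hV i).1 hi)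
    · exact hv i hi

/-- The nodes that do not lead back to an input are permuted by an injective predecessor map. -/
theorem exists_perm_of_not_rooted {f : ι → ι ⊕ μ} (hf : Function.Injective f) :
    ∃ σ : Equiv.Perm ι, (∀ i, ¬ Rooted f i → f i = .inl (σ i)) ∧
      ∀ i, Rooted f (σ i) ↔ Rooted f i := by
  classical
  have hpred : ∀ i, ¬ Rooted f i → ∃ j, f i = .inl j ∧ ¬ Rooted f j := by
    intro i hi
    rcases hfi : f i with j | s
    · exact ⟨j, rfl, fun hj => hi (.state hfi hj)⟩
    · exact absurd (.input hfi) hi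
  choose g hg hg' using hpred
  let G : {i // ¬ Rooted f i} → {i // ¬ Rooted f i} := fun i => ⟨g i.1 i.2, hg' i.1 i.2⟩
  have hG : Function.Injective G := by
    intro i j hij
    refine Subtype.ext (hf ?_)
    rw [hg i.1 i.2, hg j.1 j.2]
    exact congrArg (fun y : {i // ¬ Rooted f i} => (Sum.inl y.1 : ι ⊕ μ)) hij
  let τ : Equiv.Perm {i // ¬ Rooted f i} :=
    -- An injective self-map of a finite set is a permutation.
    Equiv.ofBijective G (Finite.injective_iff_bijective.1 hG)
  have hτ : ∀ i (hi : ¬ Rooted f i), Equiv.Perm.ofSubtype τ i = g i hi := fun i hi =>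
    Equiv.Perm.ofSubtype_apply_of_mem τ hi
  refine ⟨Equiv.Perm.ofSubtype τ, fun i hi => ?_, fun i => ?_⟩
  · rw [hτ i hi, hg i hi]
  · by_cases hi : Rooted f i
    · rw [Equiv.Perm.ofSubtype_apply_of_not_mem τ (not_not.2 hi)]
    · rw [hτ i hi]
      exact iff_of_false (hg' i hi) hi

/-- Among the controllable `σ`-invariant sets containing the rooted states, a largest one must be
everything: otherwise an incoming edge from outside its complement allows another cycle to be
attached. -/
theorem exists_controllableOn_univ [DecidableEq ι] [Fintype μ]
    [DecidableEq μ] {E : ι ⊕ μ → ι → Prop} {f : ι → ι ⊕ μ}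
    (hf : Function.Injective f) (hfE : ∀ i, E (f i) i)
    (hacc : ∀ V : Finset ι, V ≠ Finset.univ →
      ∃ c ∉ V, ∃ x, E x c ∧ ∀ j, x = .inl j → j ∈ V) :
    ∃ A B, ControllableOn E Finset.univ A B := by
  classical
  obtain ⟨σ, hσf, hσr⟩ := exists_perm_of_not_rooted hf
  let V₀ : Finset ι := Finset.univ.filter (Rooted f)
  have hV₀ : ∀ i, i ∈ V₀ ↔ Rooted f i := by simp [V₀]
  let F : Finset (Finset ι) := Finset.univ.filter fun V =>
    V₀ ⊆ V ∧ (∀ i, σ i ∈ V ↔ i ∈ V) ∧ ∃ A B, ControllableOn E V A B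
  have hF : ∀ V, V ∈ F ↔
      V₀ ⊆ V ∧ (∀ i, σ i ∈ V ↔ i ∈ V) ∧ ∃ A B, ControllableOn E V A B := by simp [F]
  have hne : F.Nonempty := ⟨V₀, (hF _).2 ⟨subset_rfl, fun i => by rw [hV₀, hV₀, hσr],
    exists_controllableOn_rooted hf hfE V₀ hV₀⟩⟩
  obtain ⟨V, hV, hmax⟩ := F.exists_max_image Finset.card hne
  obtain ⟨h0, hσ, A, B, hAB⟩ := (hF V).1 hV
  by_cases hu : V = Finset.univ
  · exact ⟨A, B, hu ▸ hAB⟩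
  · obtain ⟨c, hc, x, hxc, hx⟩ := hacc V hu
    obtain ⟨V', A', B', hlt, hσ', h'⟩ := hAB.add_cycle σ hσ (fun i hi => by
      rw [← hσf i fun hr => hi (h0 ((hV₀ i).2 hr))]
      exact hfE i) hc hx hxc
    have := hmax V' ((hF V').2 ⟨h0.trans hlt.subset, hσ', A', B', h'⟩)
    exact absurd (Finset.card_lt_card hlt) (not_lt.2 this)

/-- Lin's theorem, sufficiency: an input-accessible graph with a system of distinct predecessors
supports a controllable real pair. -/
theorem exists_real_controllable [DecidableEq ι] [Fintype μ]
    [DecidableEq μ] {E : ι ⊕ μ → ι → Prop} {f : ι → ι ⊕ μ}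
    (hf : Function.Injective f) (hfE : ∀ i, E (f i) i)
    (hacc : ∀ V : Finset ι, V ≠ Finset.univ →
      ∃ c ∉ V, ∃ x, E x c ∧ ∀ j, x = .inl j → j ∈ V) :
    ∃ (A : Matrix ι ι ℝ) (B : Matrix ι μ ℝ), (∀ i j, A i j ≠ 0 → E (.inl j) i) ∧
      (∀ i s, B i s ≠ 0 → E (.inr s) i) ∧
      ∀ v : ι → ℝ, (∀ k : ℕ, v ᵥ* (A ^ k * B) = 0) → v = 0 := by
  obtain ⟨A, B, h⟩ := exists_controllableOn_univ hf hfE hacc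
  have hA : (A.map Complex.re).map (algebraMap ℝ ℂ) = A := by
    ext i j
    exact Complex.ext (by simp) (by simp [h.im_A])
  have hB : (B.map Complex.re).map (algebraMap ℝ ℂ) = B := by
    ext i j
    exact Complex.ext (by simp) (by simp [h.im_B])
  refine ⟨A.map Complex.re, B.map Complex.re, fun i j hij => h.edge_A i j fun e => hij ?_,
    fun i s his => h.edge_B i s fun e => his ?_, fun v hv => ?_⟩
  · simp [e]
  · simp [e]
  · have hC := h.hautus.eq_zero_of_vecMul_pow h.supp_A (v := fun i => algebraMap ℝ ℂ (v i))
      (by simp) (fun k => by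
        have h1 : (A ^ k * B) = ((A.map Complex.re) ^ k * B.map Complex.re).map (algebraMap ℝ ℂ) := by
          rw [Matrix.map_mul, hB, Matrix.map_pow, hA]
        rw [h1]
        ext s
        have h2 := congrArg (algebraMap ℝ ℂ) (congrFun (hv k) s)
        rw [RingHom.map_vecMul] at h2
        simpa [Function.comp_def] using h2)
    ext i
    have := congrFun hC i
    simpa using this

end Growth

/-! ### Distinct representatives from independent rows -/

section Transversal

open Matrix

/-- A matrix with linearly independent rows has a system of distinct columns meeting the rows in
nonzero entries. -/
theorem exists_injective_entry_ne_zero {ι κ : Type*} [Fintype ι] [Fintype κ]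
    (M : Matrix ι κ ℝ) (hM : ∀ v, v ᵥ* M = 0 → v = 0) :
    ∃ f : ι → κ, Function.Injective f ∧ ∀ i, M i (f i) ≠ 0 := by
  classical
  let t : ι → Finset κ := fun i => Finset.univ.filter fun k => M i k ≠ 0
  obtain ⟨f, hf, hft⟩ := (Finset.all_card_le_biUnion_card_iff_exists_injective t).1 (by
    intro s
    let g : s → (s.biUnion t) → ℝ := fun i k => M i k
    -- Hall's condition: the rows in `s` vanish outside the columns of `s.biUnion t`, so they stay
    -- independent when restricted to those columns.
    have hg : LinearIndependent ℝ g := by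
      rw [Fintype.linearIndependent_iff]
      intro c hc
      let v : ι → ℝ := fun i => if h : i ∈ s then c ⟨i, h⟩ else 0
      have hsum : ∀ k, (v ᵥ* M) k = ∑ i : s, c i * M i k := by
        intro k
        have hvc : ∀ i : s, c i = v i := fun i => by simp [v]
        simp only [hvc, Finset.sum_coe_sort s fun i => v i * M i k]
        refine (Finset.sum_subset s.subset_univ fun i _ hi => ?_).symm
        simp [v, hi]
      have hv : v = 0 := by
        refine hM v ?_
        ext k
        rw [hsum]
        by_cases hk : k ∈ s.biUnion t
        · simpa [g] using congrFun hc ⟨k, hk⟩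
        · refine Finset.sum_eq_zero fun i _ => ?_
          have : M i k = 0 := by
            by_contra hne
            exact hk (Finset.mem_biUnion.2 ⟨i, i.2, by simpa [t] using hne⟩)
          rw [this, mul_zero]
      intro i
      simpa [v] using congrFun hv i
    have := hg.fintype_card_le_finrank
    rwa [Module.finrank_fintype_fun_eq_card, Fintype.card_coe, Fintype.card_coe] at this)
  exact ⟨f, hf, fun i => by simpa [t] using hft i⟩

end Transversal

/-! ### From distinct predecessors to disjoint stems and cycles -/

section Segments

open Equiv

variable {ι μ : Type*} [Fintype ι] [Fintype μ]

theorem exists_perm_extending_pred {f : ι → ι ⊕ μ} (hf : Function.Injective f) :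
    ∃ π : Perm (ι ⊕ μ), ∀ i, π (f i) = .inl i := by
  classical
  let e : {y // y ∈ Set.range f} ≃ {y : ι ⊕ μ // y ∈ Set.range (Sum.inl : ι → ι ⊕ μ)} :=
    (Equiv.ofInjective f hf).symm.trans (Equiv.ofInjective _ Sum.inl_injective)
  refine ⟨e.extendSubtype, fun i => ?_⟩
  rw [e.extendSubtype_apply_of_mem _ ⟨i, rfl⟩]
  simp only [e, Equiv.trans_apply]
  rw [show (⟨f i, ⟨i, rfl⟩⟩ : {y // y ∈ Set.range f}) = Equiv.ofInjective f hf i from rfl,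
    Equiv.symm_apply_apply]
  rfl

/-- For a permutation of states and inputs, the number of steps in which the input `s` first
returns to the set of inputs. -/
theorem exists_first_return (π : Perm (ι ⊕ μ)) (s : μ) :
    ∃ k, 0 < k ∧ (∃ s', (π ^ k) (.inr s) = .inr s') ∧
      ∀ j, 0 < j → j < k → ∀ s', (π ^ j) (.inr s) ≠ .inr s' := by
  classical
  have h : ∃ k, 0 < k ∧ ∃ s', (π ^ k) (.inr s) = .inr s' :=
    ⟨orderOf π, orderOf_pos π, s, by rw [pow_orderOf_eq_one]; rfl⟩
  exact ⟨Nat.find h, (Nat.find_spec h).1, (Nat.find_spec h).2, fun j h0 hj s' e =>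
    Nat.find_min h hj ⟨h0, s', e⟩⟩

namespace StructuredSystem

/-- If the states carry distinct predecessors `f i`, then the states with `f i → i` an edge of a
structured system are coverable, provided the other states are fixed by `f`. -/
theorem coverable_of_injective {π' : Type*} (S : StructuredSystem ι μ π') {f : ι → ι ⊕ μ}
    (hf : Function.Injective f) (T : Finset ι) (hT : ∀ i, f i ≠ .inl i → S.graph.Adj (f i) (.inl i))
    (hne : ∀ i ∈ T, f i ≠ .inl i) : S.Coverable T := by
  classical
  obtain ⟨π, hπ⟩ := exists_perm_extending_pred hf
  have hadj : ∀ a i, π a = .inl i → a ≠ .inl i → S.graph.Adj a (.inl i) := by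
    intro a i ha hai
    have : a = f i := π.injective (ha.trans (hπ i).symm)
    subst this
    exact hT i hai
  choose K hK0 hKr hKmin using exists_first_return π
  have hKstate : ∀ s j, 0 < j → j < K s → ∃ i, (π ^ j) (.inr s) = .inl i := by
    intro s j h0 hj
    rcases h : (π ^ j) (.inr s) with i | s'
    · exact ⟨i, rfl⟩
    · exact absurd h (hKmin s j h0 hj s')
  -- Cancelling `π ^ a` from a coincidence of two segments would make an input return too early;
  -- hence segments neither repeat nodes nor meet.
  have hback : ∀ s s' a b, a ≤ b → b < K s' → (π ^ a) (.inr s) = (π ^ b) (.inr s') →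
      a = b ∧ s = s' := by
    intro s s' a b hab hb h
    obtain ⟨d, rfl⟩ := Nat.exists_eq_add_of_le hab
    rw [pow_add, Perm.mul_apply] at h
    have h' := (π ^ a).injective h
    rcases Nat.eq_zero_or_pos d with rfl | hd
    · simpa using h'
    · exact absurd h'.symm (hKmin s' d hd (by omega) s)
  let seg : μ → List (ι ⊕ μ) := fun s => (List.range (K s)).map fun j => (π ^ j) (.inr s)
  have hseg : ∀ s y, y ∈ seg s ↔ ∃ j < K s, (π ^ j) (.inr s) = y := by simp [seg]
  -- A fixed representative makes all states of one cycle yield the same list; distinct rotations of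
  -- it would break pairwise disjointness.
  let rep : ι ⊕ μ → ι ⊕ μ := fun a => (Quotient.mk (Perm.SameCycle.setoid π) a).out
  have hrep : ∀ a, π.SameCycle (rep a) a := fun a =>
    Quotient.exact (s := Perm.SameCycle.setoid π) (Quotient.out_eq _)
  have hrep_eq : ∀ a b, π.SameCycle a b → rep a = rep b := fun a b h =>
    congrArg Quotient.out (Quotient.sound (s := Perm.SameCycle.setoid π) h)
  let free : ι ⊕ μ → Prop := fun a => ∀ s, ¬ π.SameCycle a (.inr s)
  -- A segment with `K s = 1` is a lone input, which is not a stem.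
  let P : Set (List (ι ⊕ μ)) := {l | (∃ s, 1 < K s ∧ l = seg s) ∨
    ∃ i ∈ T, free (.inl i) ∧ l = π.toList (rep (.inl i))}
  have hmove : ∀ i ∈ T, Sum.inl i ∈ π.support := by
    intro i hi
    rw [Perm.mem_support]
    intro e
    exact hne i hi (π.injective ((hπ i).trans e.symm))
  have hmem : ∀ i ∈ T, ∀ y, y ∈ π.toList (rep (.inl i)) ↔ π.SameCycle (.inl i) y := by
    intro i hi y
    rw [Perm.mem_toList_iff, (hrep (.inl i)).mem_support_iff]
    exact ⟨fun h => (hrep _).symm.trans h.1, fun h => ⟨(hrep _).trans h, hmove i hi⟩⟩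
  refine ⟨P, ?_, ?_, ?_⟩
  · rintro l (⟨s, hs, rfl⟩ | ⟨i, hi, hfree, rfl⟩)
    · left
      have hlen : (seg s).length = K s := by simp [seg]
      have hget : ∀ j (hj : j < (seg s).length), (seg s)[j] = (π ^ j) (.inr s) := by
        intro j hj
        simp [seg]
      have hnd : (seg s).Nodup := by
        refine List.Nodup.map_on ?_ List.nodup_range
        intro a ha b hb hab
        rw [List.mem_range] at ha hb
        rcases le_total a b with h | h
        · exact (hback s s a b h hb hab).1
        · exact (hback s s b a h ha hab.symm).1.symm
      refine ⟨hnd, ?_, ⟨s, ?_⟩, ?_⟩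
      · rw [List.isChain_iff_getElem]
        intro j hj
        obtain ⟨i, hi⟩ := hKstate s (j + 1) (by omega) (by omega)
        rw [hget, hget, hi]
        refine hadj _ _ (by rw [← Perm.mul_apply, ← pow_succ', hi]) ?_
        rw [← hi]
        intro e
        have := (hback s s j (j + 1) (by omega) (by omega) e).1
        omega
      · rw [List.head?_eq_getElem?, List.getElem?_eq_getElem (by omega), hget]
        simp
      · obtain ⟨i, hi⟩ := hKstate s (K s - 1) (by omega) (by omega)
        refine ⟨i, ?_⟩
        rw [List.getLast?_eq_getElem?, List.getElem?_eq_getElem (by omega), hget, hlen, hi]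
    · right
      set a := rep (.inl i) with ha
      have hasupp : a ∈ π.support := (hrep (.inl i)).mem_support_iff.2 (hmove i hi)
      have hpos := Perm.length_toList_pos_of_mem_support π a hasupp
      have hstep : ∀ y, y ∈ π.toList a → S.graph.Adj y (π y) := by
        intro y hy
        have hy' := (hmem i hi y).1 hy
        have hysupp : y ∈ π.support := hy'.mem_support_iff.1 (hmove i hi)
        rcases hπy : π y with j | s
        · refine hadj y j hπy fun e => ?_
          rw [Perm.mem_support, hπy] at hysupp
          exact hysupp e.symm
        · exact absurd (hπy ▸ Perm.sameCycle_apply_right.2 hy') (hfree s)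
      refine ⟨Perm.nodup_toList π a, ?_, List.ne_nil_of_length_pos hpos, ?_⟩
      · rw [List.isChain_iff_getElem]
        intro j hj
        have h1 := hstep _ (List.getElem_mem (by omega : j < (π.toList a).length))
        rw [Perm.getElem_toList] at h1 ⊢
        rw [Perm.getElem_toList, pow_succ', Perm.mul_apply]
        exact h1
      · have h1 := hstep _ (List.getLast_mem (List.ne_nil_of_length_pos hpos))
        convert h1 using 1
        rw [List.getLast_eq_getElem, List.head_eq_getElem, Perm.getElem_toList,
          Perm.getElem_toList, ← Perm.mul_apply, ← pow_succ', Nat.sub_add_cancel hpos,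
          Perm.length_toList, ← (Perm.isCycle_cycleOf π (Perm.mem_support.1 hasupp)).orderOf,
          ← Perm.cycleOf_pow_apply_self π a (orderOf _), pow_orderOf_eq_one, pow_zero]
  · rintro l (⟨s, hs, rfl⟩ | ⟨i, hi, hfi, rfl⟩) l' (⟨s', hs', rfl⟩ | ⟨i', hi', hfi', rfl⟩) hll y hy hy'
    · obtain ⟨a, ha, rfl⟩ := (hseg _ _).1 hy
      obtain ⟨b, hb, hab⟩ := (hseg _ _).1 hy'
      refine hll ?_
      rcases le_total a b with h | h
      · rw [(hback s s' a b h hb hab.symm).2]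
      · rw [(hback s' s b a h ha hab).2]
    · obtain ⟨a, ha, rfl⟩ := (hseg _ _).1 hy
      exact hfi' s (Perm.sameCycle_pow_right.1 ((hmem _ hi' _).1 hy'))
    · obtain ⟨a, ha, rfl⟩ := (hseg _ _).1 hy'
      exact hfi s' (Perm.sameCycle_pow_right.1 ((hmem _ hi _).1 hy))
    · refine hll ?_
      rw [hrep_eq _ _ (((hmem _ hi _).1 hy).trans ((hmem _ hi' _).1 hy').symm)]
  · intro i hi
    by_cases hfree : free (.inl i)
    · exact ⟨_, Or.inr ⟨i, hi, hfree, rfl⟩, (hmem i hi _).2 (Perm.SameCycle.refl _ _)⟩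
    · simp only [free, not_forall, not_not] at hfree
      obtain ⟨s₀, hs₀⟩ := hfree
      have hex : ∃ k : ℕ, ∃ s, (π ^ k) (.inr s) = .inl i := by
        obtain ⟨k, -, hk⟩ := hs₀.symm.exists_pow_eq'
        exact ⟨k, s₀, hk⟩
      -- With the fewest steps from any input, the state is reached before the first return of `s`;
      -- otherwise starting at the input of that return would be shorter.
      obtain ⟨s, hs⟩ := Nat.find_spec hex
      have hlt : Nat.find hex < K s := by
        by_contra hge
        obtain ⟨s', hs'⟩ := hKr s
        obtain ⟨d, hd⟩ := Nat.exists_eq_add_of_le (not_lt.1 hge)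
        refine Nat.find_min hex (m := d) (by have := hK0 s; omega) ⟨s', ?_⟩
        rw [← hs', ← Perm.mul_apply, ← pow_add, add_comm d, ← hd, hs]
      have h0 : 0 < Nat.find hex := by
        rw [Nat.pos_iff_ne_zero]
        intro e
        rw [e] at hs
        simp at hs
      exact ⟨_, Or.inl ⟨s, by omega, rfl⟩, (hseg _ _).2 ⟨_, hlt, hs⟩⟩

end StructuredSystem

end Segments

/-! ### Full row rank through left kernels -/

section Rank

open Matrix

theorem Matrix.rank_eq_card_iff_vecMul {ι κ : Type*} [Fintype ι] [Fintype κ] (M : Matrix ι κ ℝ) :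
    M.rank = Fintype.card ι ↔ ∀ v, v ᵥ* M = 0 → v = 0 := by
  rw [M.rank_eq_finrank_span_row, eq_comm]
  change Fintype.card ι = (Set.range M.row).finrank ℝ ↔ _
  rw [← linearIndependent_iff_card_eq_finrank_span, ← Matrix.vecMul_injective_iff]
  exact injective_iff_map_eq_zero M.vecMulLinear

/-- By Cayley–Hamilton, the first `card ι` Markov parameters determine whether all vanish. -/
theorem Matrix.vecMul_pow_mul_eq_zero {ι μ : Type*} [Fintype ι] [DecidableEq ι]
    (A : Matrix ι ι ℝ) (B : Matrix ι μ ℝ) (v : ι → ℝ)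
    (h : ∀ k < Fintype.card ι, v ᵥ* (A ^ k * B) = 0) (k : ℕ) : v ᵥ* (A ^ k * B) = 0 := by
  cases isEmpty_or_nonempty ι
  · rw [Subsingleton.elim v 0, zero_vecMul]
  have hdeg : (Polynomial.X ^ k %ₘ A.charpoly).natDegree < Fintype.card ι := by
    rw [← A.charpoly_natDegree_eq_dim]
    refine Polynomial.natDegree_modByMonic_lt _ A.charpoly_monic fun e => ?_
    have := A.charpoly_natDegree_eq_dim
    rw [e, Polynomial.natDegree_one] at this
    exact Fintype.card_ne_zero this.symm
  rw [A.pow_eq_aeval_mod_charpoly, Polynomial.aeval_eq_sum_range' hdeg, Matrix.sum_mul,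
    ← Matrix.vecMulLinear_apply]
  ext s
  simp only [vecMulLinear_apply, vecMul_sum, Finset.sum_apply, Pi.zero_apply]
  refine Finset.sum_eq_zero fun j hj => ?_
  rw [Matrix.smul_mul, vecMul_smul, h j (Finset.mem_range.1 hj), smul_zero]
  rfl

end Rank

/-! ### Controllability of the modified network -/

namespace Network

open Matrix

variable {n m : ℕ}

/-- With all orders equal to one, `C` is the identity up to the relabelling of `Σ _ : Fin n, Fin 1`
by `Fin n`. -/
theorem output_mul_controllabilityMatrix (C : Matrix (Fin n) (Σ _ : Fin n, Fin 1) ℝ)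
    (hC : ∀ i p, p.1 ≠ i → C i p = 0) (hC' : ∀ i p, p.1 = i → C i p = 1)
    (A : Matrix (Fin n) (Fin n) ℝ) (B : Matrix (Fin n) (Fin m) ℝ) :
    C * controllabilityMatrix (A.submatrix (Equiv.sigmaUnique (Fin n) fun _ => Fin 1)
      (Equiv.sigmaUnique (Fin n) fun _ => Fin 1))
      (B.submatrix (Equiv.sigmaUnique (Fin n) fun _ => Fin 1) id) =
    Matrix.of fun i p => (A ^ (p.1 : ℕ) * B) i p.2 := by
  set e := Equiv.sigmaUnique (Fin n) fun _ => Fin 1 with he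
  have hpow : ∀ k : ℕ, (A.submatrix e e) ^ k = (A ^ k).submatrix e e := fun k =>
    (map_pow (Matrix.reindexAlgEquiv ℝ ℝ e.symm) A k).symm
  ext i p
  rw [Matrix.mul_apply, Finset.sum_eq_single (e.symm i)]
  · rw [hC' i (e.symm i) rfl, one_mul, controllabilityMatrix, Matrix.of_apply, Matrix.of_apply,
      hpow, Matrix.submatrix_mul_equiv, Matrix.submatrix_apply, Equiv.apply_symm_apply]
    rfl
  · intro q _ hq
    rw [hC i q fun h => hq (by rw [Equiv.eq_symm_apply]; exact h), zero_mul]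
  · simp

/-- Structural output controllability of the modified network, in terms of pairs `(A, B)` indexed
by the subsystems. -/
theorem structurallyOutputControllable_iff (N : Network n m) (R : Finset (Fin n)) :
    (N.replaceFirstOrder R).StructurallyOutputControllable ↔
      ∃ (A : Matrix (Fin n) (Fin n) ℝ) (B : Matrix (Fin n) (Fin m) ℝ),
        (∀ i j, A i j ≠ 0 → (i = j ∧ i ∈ R) ∨ (i ≠ j ∧ N.G₀.Adj j i)) ∧
        (∀ i s, B i s ≠ 0 → N.inp i s) ∧
        ∀ v : Fin n → ℝ, (∀ k : ℕ, v ᵥ* (A ^ k * B) = 0) → v = 0 := by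
  set e := Equiv.sigmaUnique (Fin n) fun _ => Fin 1 with he
  constructor
  · rintro ⟨A, B, C, ⟨hA, hB, hC, hC'⟩, hrank⟩
    have hA' : A = (A.submatrix e.symm e.symm).submatrix e e := by simp
    have hB' : B = (B.submatrix e.symm id).submatrix e id := by simp
    refine ⟨A.submatrix e.symm e.symm, B.submatrix e.symm id, fun i j hij => ?_,
      fun i s his => ?_, fun v hv => ?_⟩
    · by_contra hne
      exact hij (hA _ _ hne)
    · by_contra hne
      exact his (hB _ _ hne)
    · rw [hA', hB', output_mul_controllabilityMatrix C hC fun i p h => hC' i p h rfl,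
        rank_eq_card_iff_vecMul] at hrank
      refine hrank v ?_
      ext p
      exact congrFun (hv p.1) p.2
  · rintro ⟨A, B, hA, hB, hv⟩
    refine ⟨A.submatrix e e, B.submatrix e id, fun i p => if p.1 = i then 1 else 0,
      ⟨fun p q hpq => ?_, fun p s hps => ?_, fun i p h => if_neg h, fun i p h _ => if_pos h⟩, ?_⟩
    · by_contra hne
      exact hpq (hA _ _ hne)
    · by_contra hne
      exact hps (hB _ _ hne)
    · rw [output_mul_controllabilityMatrix _ (fun i p h => if_neg h) fun i p h => if_pos h,
        rank_eq_card_iff_vecMul]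
      refine fun v h => hv v (vecMul_pow_mul_eq_zero A B v fun k hk => ?_)
      ext s
      exact congrFun h (⟨k, by simpa using hk⟩, s)

/-- A vector with `v A = 0` and `v B = 0` annihilates every `A ^ k * B`, so the rows of `[A B]` are
independent and have distinct representatives. -/
theorem exists_injective_pred_of_controllable {N : Network n m} {R : Finset (Fin n)}
    (h : (N.replaceFirstOrder R).StructurallyOutputControllable) :
    ∃ f : Fin n → Fin n ⊕ Fin m, Function.Injective f ∧ (∀ i, f i = .inl i → i ∈ R) ∧
      ∀ i, f i ≠ .inl i → N.original.graph.Adj (f i) (.inl i) := by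
  obtain ⟨A, B, hA, hB, hv⟩ := (N.structurallyOutputControllable_iff R).1 h
  obtain ⟨f, hf, hfM⟩ := exists_injective_entry_ne_zero (Matrix.fromCols A B) (by
    intro v hvM
    rw [vecMul_fromCols] at hvM
    have h1 : v ᵥ* A = 0 := funext fun j => congrFun hvM (.inl j)
    have h2 : v ᵥ* B = 0 := funext fun s => congrFun hvM (.inr s)
    refine hv v fun k => ?_
    cases k with
    | zero => rw [pow_zero, Matrix.one_mul, h2]
    | succ k => rw [pow_succ', Matrix.mul_assoc, ← vecMul_vecMul, h1, zero_vecMul])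
  refine ⟨f, hf, fun i hi => ?_, fun i hi => ?_⟩
  · have := hfM i
    rw [hi] at this
    rcases hA i i this with h | h
    · exact h.2
    · exact absurd rfl h.1
  · have := hfM i
    rcases hfi : f i with j | s
    · rw [hfi] at this hi
      rcases hA i j this with h | h
      · exact absurd (by rw [h.1]) hi
      · exact h.2
    · rw [hfi] at this
      exact hB i s this

end Network

/-! ### From a maximum covering to distinct predecessors -/

namespace StructuredSystem

variable {ι μ π : Type*}

/-- `List.prev` wraps from the head to the last node. This is an edge on a cycle, and the head of a
stem is an input, so the wrap never occurs at a state there. -/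
theorem adj_prev [DecidableEq (ι ⊕ μ)] (S : StructuredSystem ι μ π) {l : List (ι ⊕ μ)}
    (hl : S.IsStem l ∨ S.IsElementaryCycle l) {i : ι} (hi : Sum.inl i ∈ l) :
    S.graph.Adj (l.prev _ hi) (.inl i) := by
  have hchain : l.IsChain S.graph.Adj := hl.elim (fun h => h.2.1) fun h => h.2.1
  have hne := List.ne_nil_of_mem hi
  by_cases hhead : Sum.inl i = l.head hne
  · rcases hl with ⟨-, -, ⟨s, hs⟩, -⟩ | ⟨-, -, _, h⟩
    · rw [List.head?_eq_some_head hne, ← hhead] at hs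
      simp at hs
    · have := l.prev_head_eq_getLast hne
      simp only [← hhead] at this h
      rwa [this]
  · have := hchain.infix (List.prev_infix_of_mem_tail hi hhead)
    simpa using this

/-- A maximum coverable set carries distinct predecessors along edges; the remaining states are
not predecessors. -/
theorem IsMaxCoverable.exists_injective_pred {S : StructuredSystem ι μ π} {Z : Finset ι}
    (hZ : S.IsMaxCoverable Z) :
    ∃ f : ι → ι ⊕ μ, Function.Injective f ∧ (∀ i ∉ Z, f i = .inl i) ∧
      ∀ i ∈ Z, S.graph.Adj (f i) (.inl i) := by
  classical
  obtain ⟨⟨P, hP, hdisj, hcov⟩, hmax⟩ := hZ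
  -- By maximality the covering meets no state outside `Z`, so predecessors taken inside it cannot
  -- clash with the fixed states off `Z`.
  have hin : ∀ l ∈ P, ∀ i, Sum.inl i ∈ l → i ∈ Z := by
    intro l hl i hi
    by_contra hiZ
    have := hmax (insert i Z) ⟨P, hP, hdisj, fun j hj => by
      rcases Finset.mem_insert.1 hj with rfl | hj
      · exact ⟨l, hl, hi⟩
      · exact hcov j hj⟩
    rw [Finset.card_insert_of_notMem hiZ] at this
    omega
  choose! L hLP hL using hcov
  have hnd : ∀ l ∈ P, l.Nodup := fun l hl => (hP l hl).elim (fun h => h.1) fun h => h.1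
  let f : ι → ι ⊕ μ := fun i => if h : i ∈ Z then (L i).prev _ (hL i h) else .inl i
  have hfZ : ∀ i (h : i ∈ Z), f i = (L i).prev _ (hL i h) := fun i h => dif_pos h
  have hfZ' : ∀ i ∉ Z, f i = .inl i := fun i h => dif_neg h
  have hmix : ∀ i ∈ Z, ∀ j ∉ Z, f i ≠ f j := by
    intro i hi j hj e
    rw [hfZ' j hj, hfZ i hi] at e
    exact hj (hin (L i) (hLP i hi) j (e ▸ List.prev_mem _ _ _))
  have hnext : ∀ i ∈ Z, ∀ (l : List (ι ⊕ μ)) (y : ι ⊕ μ), L i = l → ∀ hy : y ∈ l, f i = y →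
      l.next y hy = .inl i := by
    rintro i hi _ y rfl hy hfy
    rw [hfZ i hi] at hfy
    subst hfy
    exact List.next_prev _ (hnd _ (hLP i hi)) _ (hL i hi)
  refine ⟨f, fun i j hij => ?_, hfZ', fun i hi => ?_⟩
  · by_cases hi : i ∈ Z <;> by_cases hj : j ∈ Z
    · have hmi : f i ∈ L i := hfZ i hi ▸ List.prev_mem _ _ (hL i hi)
      have hmj : f j ∈ L j := hfZ j hj ▸ List.prev_mem _ _ (hL j hj)
      have hLL : L i = L j := by
        by_contra hne
        exact hdisj (hLP i hi) (hLP j hj) hne hmi (hij ▸ hmj)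
      have h1 := hnext i hi (L j) _ hLL (hij ▸ hmj) rfl
      have h2 := hnext j hj (L j) _ rfl (hij ▸ hmj) hij.symm
      exact Sum.inl_injective (h1.symm.trans h2)
    · exact absurd hij (hmix i hi j hj)
    · exact absurd hij.symm (hmix j hj i hi)
    · rw [hfZ' i hi, hfZ' j hj] at hij
      exact Sum.inl_injective hij
  · rw [hfZ i hi]
    exact S.adj_prev (hP _ (hLP i hi)) (hL i hi)

/-- A path from an input or a state of `V` to a state outside `V` leaves `V` along an edge. -/
theorem exists_crossing_edge (S : StructuredSystem ι μ π) (V : Finset ι) {i : ι} (hi : i ∉ V) :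
    ∀ (l : List (ι ⊕ μ)) (x : ι ⊕ μ), (x :: l).IsChain S.graph.Adj →
      (∀ j, x = .inl j → j ∈ V) → (x :: l).getLast? = some (.inl i) →
      ∃ c ∉ V, ∃ y, S.graph.Adj y (.inl c) ∧ ∀ j, y = .inl j → j ∈ V
  | [], x, _, hx, hlast => absurd (hx i (by simpa using hlast)) hi
  | y :: l, x, hch, hx, hlast => by
    rw [List.isChain_cons_cons] at hch
    by_cases hy : ∀ j, y = .inl j → j ∈ V
    · exact exists_crossing_edge S V hi l y hch.2 hy (by simpa using hlast)
    · push Not at hy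
      obtain ⟨c, rfl, hc⟩ := hy
      exact ⟨c, hc, x, hch.1, hx⟩

theorem InputAccessible.exists_edge [Fintype ι] {S : StructuredSystem ι μ π}
    (h : S.InputAccessible) {V : Finset ι} (hV : V ≠ Finset.univ) :
    ∃ c ∉ V, ∃ y, S.graph.Adj y (.inl c) ∧ ∀ j, y = .inl j → j ∈ V := by
  obtain ⟨i, hi⟩ : ∃ i, i ∉ V := by
    by_contra! hall
    exact hV (Finset.eq_univ_iff_forall.2 hall)
  obtain ⟨l, ⟨-, hch, ⟨s, hs⟩, -⟩, hlast⟩ := h i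
  cases l with
  | nil => simp at hs
  | cons x l =>
    obtain rfl : x = .inr s := by simpa using hs
    exact S.exists_crossing_edge V hi l _ hch (by simp) hlast

end StructuredSystem

theorem lemma3 (n m : ℕ) (N : Network n m) (hacc : N.original.InputAccessible)
    (Z : Finset (Fin n)) (hZ : N.original.IsMaxCoverable Z) :
    IsLeast {k : ℕ | ∃ R : Finset (Fin n), R.card = k ∧
      (N.replaceFirstOrder R).StructurallyOutputControllable} (n - Z.card) := by
  constructor
  · refine ⟨Zᶜ, by rw [Finset.card_compl, Fintype.card_fin], ?_⟩
    obtain ⟨f, hf, hf1, hf2⟩ := hZ.exists_injective_pred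
    let E : Fin n ⊕ Fin m → Fin n → Prop := fun y i =>
      N.original.graph.Adj y (.inl i) ∨ (y = .inl i ∧ i ∉ Z)
    obtain ⟨A, B, hA, hB, hv⟩ := exists_real_controllable (E := E) hf
      (fun i => by
        by_cases hi : i ∈ Z
        · exact Or.inl (hf2 i hi)
        · exact Or.inr ⟨hf1 i hi, hi⟩)
      (fun V hV => by
        obtain ⟨c, hc, y, hy, hyV⟩ := hacc.exists_edge hV
        exact ⟨c, hc, y, Or.inl hy, hyV⟩)
    refine (N.structurallyOutputControllable_iff _).2 ⟨A, B, fun i j hij => ?_, fun i s his => ?_, hv⟩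
    · rcases hA i j hij with h | ⟨h, hi⟩
      · refine Or.inr ⟨?_, h⟩
        rintro rfl
        exact N.loopless i h
      · exact Or.inl ⟨(Sum.inl_injective h).symm, Finset.mem_compl.2 hi⟩
    · rcases hB i s his with h | ⟨h, -⟩
      · exact h
      · cases h
  · rintro k ⟨R, rfl, hR⟩
    obtain ⟨f, hf, hfR, hfE⟩ := Network.exists_injective_pred_of_controllable hR
    -- Outside `R` no state is its own predecessor, so only edges of the original graph serve there.
    have hcov := N.original.coverable_of_injective hf Rᶜ hfE fun i hi e =>
      Finset.mem_compl.1 hi (hfR i e)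
    have := hZ.2 _ hcov
    rw [Finset.card_compl, Fintype.card_fin] at this
    omega
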